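/- **Setting.** Let $S^3=\{[v]\in\mathbb{CP}^2 : v\neq 0,\ \langle v,v\rangle=0\}$, where $\langle z,w\rangle=w^*Jz$ is the Hermitian form on $\mathbb C^3$ of signature $(2,1)$ with $\langle z,w\rangle=z_0\bar w_2+z_1\bar w_1+z_2\bar w_0$, and let $PU(2,1)$ act on $S^3$. A spherical CR 3-manifold is a 3-manifold with an $(S^3,PU(2,1))$-structure. A $\mathbb C$-circle is a set of the form $S^3\cap\mathbb P(W)$ with $W\subset\mathbb C^3$ a complex plane containing a vector $v$ with $\langle v,v\rangle<0$; points of $S^3$ are generic if they are distinct and no three of them lie in a $\mathbb C$-circle. For a field $F$, the pre-Bloch group $\mathcal P(F)$ is the quotient of the free abelian group on $F\setminus\{0,1\}$ by the relations $$[x]-[y]+\Big[\frac yx\Big]-\Big[\frac{1-x^{-1}}{1-y^{-1}}\Big]+\Big[\frac{1-x}{1-y}\Big]=0,\qquad x\neq y\in F\setminus\{0,1\};$$ $\bigwedge^2F^*$ is the quotient of $F^*\otimes_{\mathbb Z}F^*$ by the subgroup generated by all $x\otimes y+y\otimes x$; and the Bloch group $\mathcal B(F)$ is the kernel of the homomorphism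 $\delta:\mathcal P(F)\to\bigwedge^2F^*$, $\delta([z])=z\wedge(1-z)$. For generic points $p_0,p_1,p_2,p_3\in S^3$ with lifts $v_i\in\mathbb C^3$, put $$[p_0,p_1,p_2,p_3]=\frac{\langle v_3,v_0\boxtimes v_1\rangle\langle v_2,v_0\rangle}{\langle v_2,v_0\boxtimes v_1\rangle\langle v_3,v_0\rangle}\in\mathbb C\setminus\{0,1\},$$ where $v\boxtimes w=(\bar v_0\bar w_1-\bar v_1\bar w_0,\ \bar v_2\bar w_0-\bar v_0\bar w_2,\ \bar v_1\bar w_2-\bar v_2\bar w_1)$, and define in $\mathcal P(\mathbb C)$ $$\beta(p_0,p_1,p_2,p_3)=\big[[p_0,p_1,p_2,p_3]\big]+\big[[p_1,p_0,p_3,p_2]\big]+\big[[p_2,p_3,p_0,p_1]\big]+\big[[p_3,p_2,p_1,p_0]\big].$$ An (ideal) CR triangulation of a spherical CR 3-manifold $M$ expresses $M$ as a quotient of finitely many tetrahedra $\Delta_1,\dots,\Delta_k$, with vertices removed, by affine gluings of their faces in pairs. The vertices of each $\Delta_i$ are ordered so that the gluings reverse the induced orientations of the faces. Each $\Delta_i$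 is a CR tetrahedron: it comes with a development in $S^3$ (locally, the map to $M$ followed by a chart of the spherical CR structure) that extends continuously to the four ideal vertices, whose images $p^i_0,p^i_1,p^i_2,p^i_3\in S^3$ are generic. The face gluings are realized on the developments by side pairings in $PU(2,1)$. Write $\beta(\Delta_i)=\beta(p^i_0,p^i_1,p^i_2,p^i_3)$ and $\beta(M)=\sum_i\beta(\Delta_i)\in\mathcal P(\mathbb C)$. The boundary holonomy is purely parabolic if, for each ideal vertex, the holonomy (product of side pairings) along every closed path in the link of that vertex is the identity or purely parabolic, i.e. has a unipotent lift to $U(2,1)$. **Theorem.** Let $M$ be a non-compact spherical CR 3-manifold with a CR triangulation $M=\Delta_1\cup\dots\cup\Delta_k$ (ideal, since $M$ is non-compact) whose boundary holonomy is purely parabolic. Then $\beta(M)\in\mathcal B(\mathbb C)$, that is, $$\sum_i\delta(\beta(\Delta_i))=0\quad\text{in }\textstyle\bigwedge^2\mathbb C^* .$$ -/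

import Mathlib

open Topology
open scoped LinearAlgebra.Projectivization TensorProduct Matrix

noncomputable section

/-! ### The pre-Bloch group and the Bloch group of a field -/

/-- The exterior square of the multiplicative group of `F`: the quotient of `Fˣ ⊗ Fˣ` by the
subgroup generated by all `x ⊗ y + y ⊗ x` (so `x ∧ x` is 2-torsion but not imposed to vanish). -/
abbrev WedgeSq (F : Type*) [Field F] : Type _ :=
  (Additive Fˣ ⊗[ℤ] Additive Fˣ) ⧸
    AddSubgroup.closure {t : Additive Fˣ ⊗[ℤ] Additive Fˣ |
      ∃ x y : Additive Fˣ, t = x ⊗ₜ[ℤ] y + y ⊗ₜ[ℤ] x}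

/-- The class `x ∧ y`, for `x`, `y` in the multiplicative group of `F`. -/
def wedge {F : Type*} [Field F] (x y : Fˣ) : WedgeSq F :=
  QuotientAddGroup.mk (Additive.ofMul x ⊗ₜ[ℤ] Additive.ofMul y)

/-- The set `F \ {0, 1}`. -/
abbrev NonDeg (F : Type*) [Field F] : Type _ := {x : F // x ≠ 0 ∧ x ≠ 1}

namespace NonDeg

variable {F : Type*} [Field F]

/-- The element `z` of the multiplicative group. -/
def unit (z : NonDeg F) : Fˣ := Units.mk0 z.1 z.2.1

/-- The element `1 - z` of the multiplicative group. -/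
def oneSubUnit (z : NonDeg F) : Fˣ := Units.mk0 (1 - z.1) (sub_ne_zero.2 (Ne.symm z.2.2))

/-- `y / x`, for `x ≠ y`. -/
def quot₁ (x y : NonDeg F) (h : x ≠ y) : NonDeg F :=
  ⟨y.1 / x.1, div_ne_zero y.2.1 x.2.1, fun e =>
    h (Subtype.ext ((div_eq_one_iff_eq x.2.1).1 e).symm)⟩

/-- `(1 - x⁻¹) / (1 - y⁻¹)`, for `x ≠ y`. -/
def quot₂ (x y : NonDeg F) (h : x ≠ y) : NonDeg F :=
  ⟨(1 - x.1⁻¹) / (1 - y.1⁻¹),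
    div_ne_zero (sub_ne_zero.2 fun e => x.2.2 (by simpa using e.symm))
      (sub_ne_zero.2 fun e => y.2.2 (by simpa using e.symm)),
    fun e => h (Subtype.ext (by
      have hy : (1 - y.1⁻¹) ≠ 0 := sub_ne_zero.2 fun e => y.2.2 (by simpa using e.symm)
      have := (div_eq_one_iff_eq hy).1 e
      simpa using this))⟩

/-- `(1 - x) / (1 - y)`, for `x ≠ y`. -/
def quot₃ (x y : NonDeg F) (h : x ≠ y) : NonDeg F :=
  ⟨(1 - x.1) / (1 - y.1),
    div_ne_zero (sub_ne_zero.2 (Ne.symm x.2.2)) (sub_ne_zero.2 (Ne.symm y.2.2)),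
    fun e => h (Subtype.ext (by
      have := (div_eq_one_iff_eq (sub_ne_zero.2 (Ne.symm y.2.2))).1 e
      simpa using this))⟩

end NonDeg

/-- The 5-term relators
`[x] - [y] + [y/x] - [(1 - x⁻¹)/(1 - y⁻¹)] + [(1 - x)/(1 - y)]`; the three quotients have to lie
in `F \ {0, 1}`, which means `x ≠ y`. -/
def fiveTermRelators (F : Type*) [Field F] : Set (FreeAbelianGroup (NonDeg F)) :=
  {r | ∃ (x y : NonDeg F) (h : x ≠ y),
    r = FreeAbelianGroup.of x - FreeAbelianGroup.of y + FreeAbelianGroup.of (x.quot₁ y h)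
      - FreeAbelianGroup.of (x.quot₂ y h) + FreeAbelianGroup.of (x.quot₃ y h)}

/-- The pre-Bloch group `𝒫(F)`. -/
abbrev PreBloch (F : Type*) [Field F] : Type _ :=
  FreeAbelianGroup (NonDeg F) ⧸ AddSubgroup.closure (fiveTermRelators F)

/-- The generator `[z]` of the pre-Bloch group. -/
def PreBloch.of {F : Type*} [Field F] (z : NonDeg F) : PreBloch F :=
  QuotientAddGroup.mk (FreeAbelianGroup.of z)

section Delta

variable {F : Type*} [Field F]

theorem wedge_mul_left (a b c : Fˣ) : wedge (a * b) c = wedge a c + wedge b c := by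
  simp only [wedge, ofMul_mul, TensorProduct.add_tmul, QuotientAddGroup.mk_add]

theorem wedge_mul_right (a b c : Fˣ) : wedge a (b * c) = wedge a b + wedge a c := by
  simp only [wedge, ofMul_mul, TensorProduct.tmul_add, QuotientAddGroup.mk_add]

theorem wedge_inv_left (a b : Fˣ) : wedge a⁻¹ b = - wedge a b := by
  simp only [wedge, ofMul_inv, TensorProduct.neg_tmul, QuotientAddGroup.mk_neg]

theorem wedge_inv_right (a b : Fˣ) : wedge a b⁻¹ = - wedge a b := by
  simp only [wedge, ofMul_inv, TensorProduct.tmul_neg, QuotientAddGroup.mk_neg]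

theorem wedge_swap (a b : Fˣ) : wedge a b = - wedge b a := by
  rw [eq_neg_iff_add_eq_zero]
  simp only [wedge, ← QuotientAddGroup.mk_add]
  exact (QuotientAddGroup.eq_zero_iff _).2 (AddSubgroup.subset_closure ⟨_, _, rfl⟩)

/-- The map `[z] ↦ z ∧ (1 - z)` on the free abelian group. -/
def freeDelta (F : Type*) [Field F] : FreeAbelianGroup (NonDeg F) →+ WedgeSq F :=
  FreeAbelianGroup.lift fun z => wedge z.unit z.oneSubUnit

theorem freeDelta_relator {r : FreeAbelianGroup (NonDeg F)} (hr : r ∈ fiveTermRelators F) :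
    freeDelta F r = 0 := by
  obtain ⟨x, y, h, rfl⟩ := hr
  have hxy : x.1 - y.1 ≠ 0 := sub_ne_zero.2 fun e => h (Subtype.ext e)
  have hx0 := x.2.1
  have hy0 := y.2.1
  have hx1 : 1 - x.1 ≠ 0 := sub_ne_zero.2 (Ne.symm x.2.2)
  have hy1 : 1 - y.1 ≠ 0 := sub_ne_zero.2 (Ne.symm y.2.2)
  have hy1' : y.1 - 1 ≠ 0 := sub_ne_zero.2 y.2.2
  set e : Fˣ := Units.mk0 _ hxy with he
  have h1 : (x.quot₁ y h).unit = y.unit * x.unit⁻¹ := by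
    ext; simp [NonDeg.unit, NonDeg.quot₁, div_eq_mul_inv]
  have h2 : (x.quot₁ y h).oneSubUnit = e * x.unit⁻¹ := by
    ext; simp [NonDeg.unit, NonDeg.oneSubUnit, NonDeg.quot₁, he]; field_simp
  have h3 : (x.quot₂ y h).unit = y.unit * x.oneSubUnit * x.unit⁻¹ * y.oneSubUnit⁻¹ := by
    ext; simp [NonDeg.unit, NonDeg.oneSubUnit, NonDeg.quot₂]; field_simp; ring
  have h4 : (x.quot₂ y h).oneSubUnit = e * x.unit⁻¹ * y.oneSubUnit⁻¹ := by
    ext; simp [NonDeg.unit, NonDeg.oneSubUnit, NonDeg.quot₂, he]; field_simp; ring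
  have h5 : (x.quot₃ y h).unit = x.oneSubUnit * y.oneSubUnit⁻¹ := by
    ext; simp [NonDeg.unit, NonDeg.oneSubUnit, NonDeg.quot₃, div_eq_mul_inv]
  have h6 : (x.quot₃ y h).oneSubUnit = e * y.oneSubUnit⁻¹ := by
    ext; simp [NonDeg.oneSubUnit, NonDeg.quot₃, he]; field_simp; ring
  simp only [freeDelta, map_add, map_sub, FreeAbelianGroup.lift_apply_of, h1, h2, h3, h4, h5, h6,
    wedge_mul_left, wedge_mul_right, wedge_inv_left, wedge_inv_right]
  rw [wedge_swap x.oneSubUnit x.unit, wedge_swap y.oneSubUnit x.unit]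
  abel

end Delta

/-- The homomorphism `δ : 𝒫(F) → ∧² Fˣ`, `δ([z]) = z ∧ (1 - z)`. -/
def blochDelta (F : Type*) [Field F] : PreBloch F →+ WedgeSq F :=
  QuotientAddGroup.lift _ (freeDelta F) ((AddSubgroup.closure_le _).2 fun _ hr =>
    freeDelta_relator hr)

/-- The Bloch group `ℬ(F)`, the kernel of `δ`. -/
def blochGroup (F : Type*) [Field F] : AddSubgroup (PreBloch F) := (blochDelta F).ker

/-! ### The sphere `S³` and its group `PU(2,1)` of CR transformations -/

/-- The matrix of the Hermitian form of signature `(2,1)`. -/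
def matJ : Matrix (Fin 3) (Fin 3) ℂ := !![0, 0, 1; 0, 1, 0; 1, 0, 0]

/-- The Hermitian form `⟨z, w⟩ = w* J z`. -/
def herm (z w : Fin 3 → ℂ) : ℂ := star w ⬝ᵥ (matJ *ᵥ z)

theorem herm_apply (z w : Fin 3 → ℂ) :
    herm z w = star (w 0) * z 2 + star (w 1) * z 1 + star (w 2) * z 0 := by
  simp [herm, matJ, dotProduct, Matrix.mulVec, Fin.sum_univ_three]

/-- The Hermitian cross-product `v ⊠ w`, in coordinates. -/
def boxProd (v w : Fin 3 → ℂ) : Fin 3 → ℂ :=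
  ![star (v 0) * star (w 1) - star (v 1) * star (w 0),
    star (v 2) * star (w 0) - star (v 0) * star (w 2),
    star (v 1) * star (w 2) - star (v 2) * star (w 1)]

/-- The 3-sphere, as the boundary at infinity of the complex hyperbolic plane: the projectivized
cone of non-zero null vectors. -/
def S3 : Type := {p : ℙ ℂ (Fin 3 → ℂ) // ∀ v ∈ p.submodule, herm v v = 0}

/-- The cone `V₀` of non-zero null vectors. -/
abbrev NullCone : Type := {v : Fin 3 → ℂ // v ≠ 0 ∧ herm v v = 0}

/-- The projection `V₀ → S³`. -/
def S3.mk (v : NullCone) : S3 :=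
  ⟨Projectivization.mk ℂ v.1 v.2.1, by
    intro u hu
    rw [Projectivization.submodule_mk, Submodule.mem_span_singleton] at hu
    obtain ⟨c, rfl⟩ := hu
    have := v.2.2
    rw [herm_apply] at this ⊢
    simp only [Pi.smul_apply, smul_eq_mul, star_mul']
    linear_combination (star c * c) * this⟩

/-- The quotient topology from the cone of null vectors. -/
instance : TopologicalSpace S3 := TopologicalSpace.coinduced S3.mk inferInstance

/-- The chosen lift of a point of `S³` to `ℂ³`. -/
def S3.rep (p : S3) : Fin 3 → ℂ := p.1.rep

/-- The unitary group `U(2,1)` of the Hermitian form. -/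
def U21 : Subgroup (GL (Fin 3) ℂ) where
  carrier := {A | (A : Matrix (Fin 3) (Fin 3) ℂ)ᴴ * matJ * (A : Matrix (Fin 3) (Fin 3) ℂ) = matJ}
  one_mem' := by simp
  mul_mem' := by
    intro A B hA hB
    simp only [Set.mem_ofPred_eq, Units.val_mul, Matrix.conjTranspose_mul] at *
    calc _ = (B : Matrix (Fin 3) (Fin 3) ℂ)ᴴ *
          ((A : Matrix (Fin 3) (Fin 3) ℂ)ᴴ * matJ * (A : Matrix (Fin 3) (Fin 3) ℂ)) *
            (B : Matrix (Fin 3) (Fin 3) ℂ) := by simp only [Matrix.mul_assoc]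
      _ = _ := by rw [hA, hB]
  inv_mem' := by
    intro A hA
    simp only [Set.mem_ofPred_eq] at *
    have h1 : (A : Matrix (Fin 3) (Fin 3) ℂ) * ((A⁻¹ : GL (Fin 3) ℂ) : Matrix (Fin 3) (Fin 3) ℂ)
        = 1 := by rw [← Units.val_mul]; simp
    have h2 : ((A⁻¹ : GL (Fin 3) ℂ) : Matrix (Fin 3) (Fin 3) ℂ)ᴴ *
        (A : Matrix (Fin 3) (Fin 3) ℂ)ᴴ = 1 := by
      rw [← Matrix.conjTranspose_mul, h1, Matrix.conjTranspose_one]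
    calc _ = ((A⁻¹ : GL (Fin 3) ℂ) : Matrix (Fin 3) (Fin 3) ℂ)ᴴ *
          ((A : Matrix (Fin 3) (Fin 3) ℂ)ᴴ * matJ * (A : Matrix (Fin 3) (Fin 3) ℂ)) *
          ((A⁻¹ : GL (Fin 3) ℂ) : Matrix (Fin 3) (Fin 3) ℂ) := by rw [hA]
      _ = (((A⁻¹ : GL (Fin 3) ℂ) : Matrix (Fin 3) (Fin 3) ℂ)ᴴ *
          (A : Matrix (Fin 3) (Fin 3) ℂ)ᴴ) * matJ * ((A : Matrix (Fin 3) (Fin 3) ℂ) *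
          ((A⁻¹ : GL (Fin 3) ℂ) : Matrix (Fin 3) (Fin 3) ℂ)) := by
            simp only [Matrix.mul_assoc]
      _ = matJ := by rw [h1, h2, Matrix.one_mul, Matrix.mul_one]

/-- The matrix `A` induces the transformation `g` of `S³`; that is, `A` is a lift of `g`. -/
def IsLift (A : GL (Fin 3) ℂ) (g : Equiv.Perm S3) : Prop :=
  ∀ p : S3, (g p).1.submodule =
    p.1.submodule.map (Matrix.mulVecLin (A : Matrix (Fin 3) (Fin 3) ℂ))

theorem IsLift.one : IsLift 1 1 := fun p => by simp

theorem IsLift.mul {A B : GL (Fin 3) ℂ} {g h : Equiv.Perm S3} (hA : IsLift A g)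
    (hB : IsLift B h) : IsLift (A * B) (g * h) := fun p => by
  rw [Equiv.Perm.mul_apply, hA, hB, ← Submodule.map_comp, Units.val_mul, Matrix.mulVecLin_mul]

theorem IsLift.inv {A : GL (Fin 3) ℂ} {g : Equiv.Perm S3} (hA : IsLift A g) :
    IsLift A⁻¹ g⁻¹ := fun p => by
  have h := hA (g⁻¹ p)
  rw [← Equiv.Perm.mul_apply, mul_inv_cancel, Equiv.Perm.one_apply] at h
  rw [h, ← Submodule.map_comp, ← Matrix.mulVecLin_mul, ← Units.val_mul]
  simp

/-- The projective unitary group `PU(2,1)`, realized as the group of transformations of `S³`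
induced by the elements of `U(2,1)` (it acts faithfully on `S³`). -/
def PU21 : Subgroup (Equiv.Perm S3) where
  carrier := {g | ∃ A ∈ U21, IsLift A g}
  one_mem' := ⟨1, one_mem _, IsLift.one⟩
  mul_mem' := by
    rintro g h ⟨A, hA, hg⟩ ⟨B, hB, hh⟩
    exact ⟨A * B, mul_mem hA hB, hg.mul hh⟩
  inv_mem' := by
    rintro g ⟨A, hA, hg⟩
    exact ⟨A⁻¹, inv_mem hA, hg.inv⟩

/-- An element of `PU(2,1)` is purely parabolic or the identity: it has a unipotent lift. -/
def IsPurelyParabolicOrOne (g : PU21) : Prop :=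
  ∃ A ∈ U21, IsLift A g ∧ IsNilpotent ((A : Matrix (Fin 3) (Fin 3) ℂ) - 1)

theorem PU21.continuous (g : PU21) : Continuous (g : Equiv.Perm S3) := by
  obtain ⟨g, A, hA, hg⟩ := g
  refine continuous_coinduced_dom.2 ?_
  have hcone : ∀ v : NullCone, (A : Matrix (Fin 3) (Fin 3) ℂ) *ᵥ v.1 ≠ 0 ∧
      herm ((A : Matrix (Fin 3) (Fin 3) ℂ) *ᵥ v.1) ((A : Matrix (Fin 3) (Fin 3) ℂ) *ᵥ v.1) = 0 := by
    intro v
    refine ⟨fun h => v.2.1 ?_, ?_⟩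
    · have : ((A⁻¹ : GL (Fin 3) ℂ) : Matrix (Fin 3) (Fin 3) ℂ) *ᵥ
          ((A : Matrix (Fin 3) (Fin 3) ℂ) *ᵥ v.1) = v.1 := by
        rw [Matrix.mulVec_mulVec, ← Units.val_mul]; simp
      rw [← this, h, Matrix.mulVec_zero]
    · have hA' : (A : Matrix (Fin 3) (Fin 3) ℂ)ᴴ * matJ * (A : Matrix (Fin 3) (Fin 3) ℂ) = matJ :=
        hA
      have h0 := v.2.2
      rw [herm, ← hA'] at h0
      rw [herm, Matrix.star_mulVec]
      refine Eq.trans ?_ h0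
      simp only [Matrix.dotProduct_mulVec, Matrix.vecMul_vecMul, Matrix.mul_assoc]
  have key : (g ∘ S3.mk : NullCone → S3) =
      fun v => S3.mk ⟨(A : Matrix (Fin 3) (Fin 3) ℂ) *ᵥ v.1, hcone v⟩ := by
    funext v
    apply Subtype.ext
    apply Projectivization.submodule_injective
    show (g (S3.mk v)).1.submodule = _
    rw [hg]
    simp [S3.mk, Projectivization.submodule_mk, Submodule.map_span]
  show Continuous (g ∘ S3.mk)
  rw [key]
  have hmk : Continuous S3.mk := continuous_coinduced_rng
  refine hmk.comp (Continuous.subtype_mk ?_ _)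
  exact Continuous.matrix_mulVec continuous_const continuous_subtype_val

/-- Being given near every point by an element of `PU(2,1)`. -/
def sphericalCRPregroupoid : Pregroupoid S3 where
  property f s := ∀ x ∈ s, ∃ u, IsOpen u ∧ x ∈ u ∧
    ∃ g : PU21, ∀ y ∈ s ∩ u, f y = (g : Equiv.Perm S3) y
  comp := by
    intro f f' u v hf hf' _ _ _ x hx
    obtain ⟨w, hw, hxw, g, hg⟩ := hf x hx.1
    obtain ⟨w', hw', hxw', g', hg'⟩ := hf' (f x) hx.2
    refine ⟨w ∩ (g : Equiv.Perm S3) ⁻¹' w', hw.inter (hw'.preimage (PU21.continuous g)),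
      ⟨hxw, ?_⟩, g' * g, ?_⟩
    · rw [Set.mem_preimage, ← hg x ⟨hx.1, hxw⟩]; exact hxw'
    · rintro y ⟨⟨hyu, hyv⟩, hyw, hyw'⟩
      have h1 := hg y ⟨hyu, hyw⟩
      rw [Set.mem_preimage, ← h1] at hyw'
      have h2 := hg' (f y) ⟨hyv, hyw'⟩
      rw [Function.comp_apply, h2, h1]
      rfl
  id_mem := fun x _ => ⟨Set.univ, isOpen_univ, trivial, 1, fun y _ => by simp⟩
  locality := by
    intro f u _ h x hx
    obtain ⟨v, hv, hxv, hp⟩ := h x hx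
    obtain ⟨w, hw, hxw, g, hg⟩ := hp x ⟨hx, hxv⟩
    exact ⟨v ∩ w, hv.inter hw, ⟨hxv, hxw⟩, g, fun y hy => hg y ⟨⟨hy.1, hy.2.1⟩, hy.2.2⟩⟩
  congr := by
    intro f g u _ h hp x hx
    obtain ⟨w, hw, hxw, k, hk⟩ := hp x hx
    exact ⟨w, hw, hxw, k, fun y hy => (h y hy.1).trans (hk y hy)⟩

/-- The pseudogroup of local transformations of `S³` given by elements of `PU(2,1)`. A spherical
CR structure on `M` is an `(S³, PU(2,1))`-structure, that is, an atlas of charts in `S³` whose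
transition maps belong to this groupoid. -/
def sphericalCRGroupoid : StructureGroupoid S3 := sphericalCRPregroupoid.groupoid

/-! ### Generic configurations and their invariants -/

/-- A `ℂ`-circle: the boundary of a complex line of the complex hyperbolic plane, that is, the set
of points of `S³` in the projectivization of a complex plane of `ℂ³` containing negative
vectors. -/
def IsCCircle (C : Set S3) : Prop :=
  ∃ W : Submodule ℂ (Fin 3 → ℂ), Module.finrank ℂ W = 2 ∧ (∃ v ∈ W, (herm v v).re < 0) ∧
    C = {p : S3 | p.1.submodule ≤ W}

/-- Points of `S³` are generic if they are distinct and no three of them lie in a `ℂ`-circle. -/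
def Generic {n : ℕ} (p : Fin n → S3) : Prop :=
  Function.Injective p ∧ ∀ i j k : Fin n, i ≠ j → j ≠ k → i ≠ k →
    ∀ C, IsCCircle C → ¬ (p i ∈ C ∧ p j ∈ C ∧ p k ∈ C)

/-- The expression `⟨v₃, v₀ ⊠ v₁⟩ ⟨v₂, v₀⟩ / (⟨v₂, v₀ ⊠ v₁⟩ ⟨v₃, v₀⟩)`. -/
def crossRatioVec (v₀ v₁ v₂ v₃ : Fin 3 → ℂ) : ℂ :=
  (herm v₃ (boxProd v₀ v₁) * herm v₂ v₀) / (herm v₂ (boxProd v₀ v₁) * herm v₃ v₀)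

/-- The cross-ratio `[p₀, p₁, p₂, p₃]`; it does not depend on the lifts, see
`crossRatioVec_smul`. -/
def crossRatio (p₀ p₁ p₂ p₃ : S3) : ℂ := crossRatioVec p₀.rep p₁.rep p₂.rep p₃.rep

theorem herm_boxProd (u v w : Fin 3 → ℂ) : herm u (boxProd v w) =
    u 0 * (v 1 * w 2 - v 2 * w 1) + u 1 * (v 2 * w 0 - v 0 * w 2)
      + u 2 * (v 0 * w 1 - v 1 * w 0) := by
  rw [herm_apply]
  simp [boxProd]
  ring

theorem crossRatioVec_smul {v₀ v₁ v₂ v₃ : Fin 3 → ℂ} {a b c d : ℂ} (ha : a ≠ 0) (hb : b ≠ 0)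
    (hc : c ≠ 0) (hd : d ≠ 0) :
    crossRatioVec (a • v₀) (b • v₁) (c • v₂) (d • v₃) = crossRatioVec v₀ v₁ v₂ v₃ := by
  have ha' : star a ≠ 0 := star_ne_zero.2 ha
  have h1 : ∀ (x : ℂ) (u v w : Fin 3 → ℂ), herm (x • u) (boxProd (a • v) (b • w)) =
      x * (a * b) * herm u (boxProd v w) := by
    intro x u v w; simp only [herm_boxProd, Pi.smul_apply, smul_eq_mul]; ring
  have h2 : ∀ (x : ℂ) (u v : Fin 3 → ℂ), herm (x • u) (a • v) = x * star a * herm u v := by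
    intro x u v; simp only [herm_apply, Pi.smul_apply, smul_eq_mul, star_mul']; ring
  have hk : a * b * star a * c * d ≠ 0 := by simp [ha, hb, hc, hd]
  unfold crossRatioVec
  rw [h1, h1, h2, h2, ← mul_div_mul_left (herm v₃ (boxProd v₀ v₁) * herm v₂ v₀) _ hk]
  congr 1 <;> ring

theorem S3.rep_ne_zero (p : S3) : p.rep ≠ 0 := p.1.rep_nonzero

theorem S3.submodule_eq (p : S3) : p.1.submodule = ℂ ∙ p.rep := p.1.submodule_eq

theorem S3.herm_rep (p : S3) : herm p.rep p.rep = 0 :=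
  p.2 _ (by rw [S3.submodule_eq]; exact Submodule.mem_span_singleton_self _)

theorem S3.linearIndependent {p q : S3} (h : p ≠ q) : LinearIndependent ℂ ![p.rep, q.rep] :=
  Projectivization.linearIndependent_pair_iff_ne.2 fun e => h (Subtype.ext e)

theorem S3.herm_ne_zero {p q : S3} (h : p ≠ q) : herm p.rep q.rep ≠ 0 := by
  intro h0
  have hli := LinearIndependent.pair_iff.1 (S3.linearIndependent h)
  have hp := p.herm_rep
  have hq := q.herm_rep
  have hp0 := p.rep_ne_zero
  generalize p.rep = x at *
  generalize q.rep = y at *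
  have null : ∀ u : Fin 3 → ℂ, u 2 = 0 → herm u u = 0 → u 1 = 0 := by
    intro u h2 hu
    rw [herm_apply, h2] at hu
    simpa using hu
  have h0' : herm y x = 0 := by
    have : herm y x = star (herm x y) := by
      simp only [herm_apply, star_add, star_mul', star_star]; ring
    rw [this, h0, star_zero]
  by_cases hA : x 2 = 0 ∧ y 2 = 0
  · have hx1 := null x hA.1 hp
    have hy1 := null y hA.2 hq
    have := hli (y 0) (-(x 0)) (by
      ext t; fin_cases t <;> simp [hA.1, hA.2, hx1, hy1]; ring)
    refine hp0 (funext fun t => ?_)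
    have hx0 : x 0 = 0 := by simpa using this.2
    fin_cases t <;> simp [hx0, hx1, hA.1]
  · have hu2 : (y 2 • x + (-(x 2)) • y) 2 = 0 := by simp; ring
    have hu : herm (y 2 • x + (-(x 2)) • y) (y 2 • x + (-(x 2)) • y) = 0 := by
      rw [herm_apply] at hp hq h0 h0' ⊢
      simp only [Pi.add_apply, Pi.smul_apply, smul_eq_mul, star_add, star_mul', star_neg]
      linear_combination y 2 * star (y 2) * hp + x 2 * star (x 2) * hq
        - y 2 * star (x 2) * h0 - x 2 * star (y 2) * h0'
    have hu1 := null _ hu2 hu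
    have hux : (y 2 * x 0 - x 2 * y 0) * star (x 2) = 0 := by
      rw [herm_apply] at hp h0'
      simp only [Pi.add_apply, Pi.smul_apply, smul_eq_mul] at hu1
      linear_combination y 2 * hp - x 2 * h0' - star (x 1) * hu1
    have huy : (y 2 * x 0 - x 2 * y 0) * star (y 2) = 0 := by
      rw [herm_apply] at hq h0
      simp only [Pi.add_apply, Pi.smul_apply, smul_eq_mul] at hu1
      linear_combination y 2 * h0 - x 2 * hq - star (y 1) * hu1
    have hu0 : y 2 * x 0 - x 2 * y 0 = 0 := by
      by_contra hne
      exact hA ⟨by simpa [hne] using hux, by simpa [hne] using huy⟩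
    have := hli (y 2) (-(x 2)) (by
      ext t
      fin_cases t
      · simp only [Pi.add_apply, Pi.smul_apply, smul_eq_mul]
        simpa [sub_eq_add_neg] using hu0
      · exact hu1
      · exact hu2)
    exact hA ⟨by simpa using this.2, this.1⟩

theorem Generic.det_ne_zero {n : ℕ} {p : Fin n → S3} (hp : Generic p) {i j k : Fin n}
    (hij : i ≠ j) (hjk : j ≠ k) (hik : i ≠ k) :
    herm (p k).rep (boxProd (p i).rep (p j).rep) ≠ 0 := by
  intro h0
  have hne := hp.1.ne hij
  have hli := S3.linearIndependent hne
  have hh := S3.herm_ne_zero hne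
  have hmi : (p i).rep ∈ Submodule.span ℂ (Set.range ![(p i).rep, (p j).rep]) :=
    Submodule.subset_span ⟨0, rfl⟩
  have hmj : (p j).rep ∈ Submodule.span ℂ (Set.range ![(p i).rep, (p j).rep]) :=
    Submodule.subset_span ⟨1, rfl⟩
  have hmk : (p k).rep ∈ Submodule.span ℂ (Set.range ![(p i).rep, (p j).rep]) := by
    by_contra hmk
    have hind : LinearIndependent ℂ ![(p k).rep, (p i).rep, (p j).rep] :=
      linearIndependent_finCons.2 ⟨hli, hmk⟩
    have hunit := Matrix.linearIndependent_rows_iff_isUnit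
      (A := Matrix.of ![(p k).rep, (p i).rep, (p j).rep]) |>.1 hind
    have hdet := ((Matrix.isUnit_iff_isUnit_det _).1 hunit).ne_zero
    apply hdet
    rw [herm_boxProd] at h0
    rw [Matrix.det_fin_three]
    simp
    linear_combination h0
  refine hp.2 i j k hij hjk hik _ ⟨Submodule.span ℂ (Set.range ![(p i).rep, (p j).rep]),
    ?_, ⟨(p i).rep - herm (p i).rep (p j).rep • (p j).rep,
      Submodule.sub_mem _ hmi (Submodule.smul_mem _ _ hmj), ?_⟩, rfl⟩ ?_
  · simpa using finrank_span_eq_card hli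
  · have e : herm ((p i).rep - herm (p i).rep (p j).rep • (p j).rep)
        ((p i).rep - herm (p i).rep (p j).rep • (p j).rep) =
        -2 * (herm (p i).rep (p j).rep * star (herm (p i).rep (p j).rep)) := by
      have hi := S3.herm_rep (p i)
      have hj := S3.herm_rep (p j)
      have hji : star (herm (p i).rep (p j).rep) = herm (p j).rep (p i).rep := by
        simp only [herm_apply, star_add, star_mul', star_star]; ring
      rw [hji]
      have hji' := hji
      generalize hc : herm (p i).rep (p j).rep = c at *
      generalize hd : herm (p j).rep (p i).rep = d at *
      rw [herm_apply] at hi hj hc hd ⊢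
      simp only [Pi.sub_apply, Pi.smul_apply, smul_eq_mul, star_sub, star_mul']
      rw [hji]
      linear_combination hi + c * d * hj - d * hc - c * hd
    rw [e]
    have hpos : 0 < Complex.normSq (herm (p i).rep (p j).rep) := Complex.normSq_pos.2 hh
    rw [Complex.star_def, Complex.mul_conj]
    simp [hpos]
  · have hmem : ∀ (W : Submodule ℂ (Fin 3 → ℂ)) (q : S3), q.rep ∈ W → q.1.submodule ≤ W := by
      intro W q hq
      rw [S3.submodule_eq, Submodule.span_singleton_le_iff_mem]
      exact hq
    exact ⟨hmem _ _ hmi, hmem _ _ hmj, hmem _ _ hmk⟩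

theorem Generic.crossRatio_ne {n : ℕ} {p : Fin n → S3} (hp : Generic p) {i j k l : Fin n}
    (h : Function.Injective ![i, j, k, l]) :
    crossRatio (p i) (p j) (p k) (p l) ≠ 0 ∧ crossRatio (p i) (p j) (p k) (p l) ≠ 1 := by
  have hij : i ≠ j := fun e => absurd (@h 0 1 (by simpa using e)) (by decide)
  have hik : i ≠ k := fun e => absurd (@h 0 2 (by simpa using e)) (by decide)
  have hil : i ≠ l := fun e => absurd (@h 0 3 (by simpa using e)) (by decide)
  have hjk : j ≠ k := fun e => absurd (@h 1 2 (by simpa using e)) (by decide)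
  have hjl : j ≠ l := fun e => absurd (@h 1 3 (by simpa using e)) (by decide)
  have hkl : k ≠ l := fun e => absurd (@h 2 3 (by simpa using e)) (by decide)
  have d1 := hp.det_ne_zero hij hjl hil
  have d2 := hp.det_ne_zero hij hjk hik
  have d3 := hp.det_ne_zero hik hkl hil
  have n1 := S3.herm_ne_zero (hp.1.ne hik.symm)
  have n2 := S3.herm_ne_zero (hp.1.ne hil.symm)
  have n3 := S3.herm_ne_zero (hp.1.ne hij.symm)
  refine ⟨div_ne_zero (mul_ne_zero d1 n1) (mul_ne_zero d2 n2), fun e => ?_⟩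
  have e' := (div_eq_one_iff_eq (mul_ne_zero d2 n2)).1 e
  have h0 := S3.herm_rep (p i)
  refine mul_ne_zero d3 n3 ?_
  simp only [herm_boxProd] at e' ⊢
  simp only [herm_apply] at e' h0 ⊢
  linear_combination ((p l).rep 0 * ((p j).rep 1 * (p k).rep 2 - (p j).rep 2 * (p k).rep 1) +
    (p l).rep 1 * ((p j).rep 2 * (p k).rep 0 - (p j).rep 0 * (p k).rep 2) +
    (p l).rep 2 * ((p j).rep 0 * (p k).rep 1 - (p j).rep 1 * (p k).rep 0)) * h0 + e'

/-- The generator `[[p_i, p_j, p_k, p_l]]` of the pre-Bloch group attached to four of the points of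
a generic configuration. -/
def Generic.gen {n : ℕ} {p : Fin n → S3} (hp : Generic p) (i j k l : Fin n)
    (h : Function.Injective ![i, j, k, l]) : PreBloch ℂ :=
  PreBloch.of ⟨crossRatio (p i) (p j) (p k) (p l), hp.crossRatio_ne h⟩

/-- The invariant `β(p₀, p₁, p₂, p₃) = [z₀₁] + [z₁₀] + [z₂₃] + [z₃₂]` of a generic configuration of
four points, where `z₀₁ = [p₀, p₁, p₂, p₃]`, `z₁₀ = [p₁, p₀, p₃, p₂]`, `z₂₃ = [p₂, p₃, p₀, p₁]`,
`z₃₂ = [p₃, p₂, p₁, p₀]`. -/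
def configBeta {p : Fin 4 → S3} (hp : Generic p) : PreBloch ℂ :=
  hp.gen 0 1 2 3 (by decide) + hp.gen 1 0 3 2 (by decide) +
    hp.gen 2 3 0 1 (by decide) + hp.gen 3 2 1 0 (by decide)

/-! ### CR triangulations -/

/-- The tetrahedron with its vertices removed. -/
abbrev IdealTetrahedron : Type :=
  {x : stdSimplex ℝ (Fin 4) // ∀ a : Fin 4, x ≠ stdSimplex.vertex a}

/-- Combinatorial data of an oriented gluing of tetrahedra indexed by `ι`. Face `a` of a
tetrahedron is the face opposite to its vertex `a`. Face `a` of `i` is glued to face `perm i a a` of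
`adj i a` by the affine map sending vertex `b ≠ a` to vertex `perm i a b`. That `perm i a` is odd
means that the gluing reverses the orientations induced on the faces by the orderings of the
vertices: the orderings are consistent with an orientation of the glued space. -/
structure OrientedGluing (ι : Type*) where
  adj : ι → Fin 4 → ι
  perm : ι → Fin 4 → Equiv.Perm (Fin 4)
  adj_adj : ∀ i a, adj (adj i a) (perm i a a) = i
  perm_perm : ∀ i a, perm (adj i a) (perm i a a) = (perm i a)⁻¹
  not_self : ∀ i a, (adj i a, perm i a a) ≠ (i, a)
  odd : ∀ i a, Equiv.Perm.sign (perm i a) = -1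

/-- A point of a face of an ideal tetrahedron and the point to which it is glued. -/
def OrientedGluing.FaceRel {ι : Type*} (G : OrientedGluing ι)
    (x y : Σ _ : ι, IdealTetrahedron) : Prop :=
  ∃ a : Fin 4, x.2.1 a = 0 ∧ y.1 = G.adj x.1 a ∧ y.2.1 = stdSimplex.map (G.perm x.1 a) x.2.1

/-- An ideal CR triangulation of a spherical CR manifold `M`, by tetrahedra indexed by `ι`.

* `cell i` maps the `i`-th ideal tetrahedron to `M`, and these maps identify `M`, as a topological
  space, with the quotient of the disjoint union of the ideal tetrahedra by the face gluings.
* `dev i` is a development in `S³` of the `i`-th tetrahedron: near every point it is `cell i`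
  followed by a chart of the spherical CR structure; it extends continuously to the ideal vertices,
  and the four developed vertices are generic.
* `sidePairing i a` is the element of `PU(2,1)` carrying face `a` of the development of `i` to the
  face of the development of `adj i a` to which it is glued (it is unique, being determined by its
  values at the three generic vertices of the face). -/
structure CRTriangulation (M : Type*) [TopologicalSpace M] [ChartedSpace S3 M]
    (ι : Type*) extends OrientedGluing ι where
  cell : ι → IdealTetrahedron → M
  isQuotientMap : IsQuotientMap fun x : Σ _ : ι, IdealTetrahedron => cell x.1 x.2
  cell_eq_iff : ∀ x y : Σ _ : ι, IdealTetrahedron,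
    cell x.1 x.2 = cell y.1 y.2 ↔ Relation.EqvGen toOrientedGluing.FaceRel x y
  dev : ι → C(stdSimplex ℝ (Fin 4), S3)
  dev_chart : ∀ (i : ι) (x : IdealTetrahedron), ∃ e ∈ sphericalCRGroupoid.maximalAtlas M,
    cell i x ∈ e.source ∧ ∀ᶠ y in 𝓝 x, dev i y.1 = e (cell i y)
  generic : ∀ i, Generic fun a : Fin 4 => dev i (stdSimplex.vertex a)
  sidePairing : ι → Fin 4 → PU21
  sidePairing_dev : ∀ (i : ι) (a : Fin 4) (x : stdSimplex ℝ (Fin 4)), x a = 0 →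
    dev (adj i a) (stdSimplex.map (perm i a) x) = (sidePairing i a : Equiv.Perm S3) (dev i x)

namespace CRTriangulation

variable {M : Type*} [TopologicalSpace M] [ChartedSpace S3 M] {ι : Type*}

/-- Paths of corners `(i, a)` (tetrahedron `i` at its vertex `a`) around an ideal vertex of the
triangulation, together with their holonomy, the product of the side pairings of the crossed faces.
A path crosses faces containing the ideal vertex, so it is a path of triangles in the link
of that vertex, that is, in a boundary component. -/
inductive CornerPath (T : CRTriangulation M ι) (c : ι × Fin 4) : ι × Fin 4 → PU21 → Prop
  | refl : CornerPath T c c 1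
  | step {i : ι} {a : Fin 4} {g : PU21} (h : CornerPath T c (i, a) g) (f : Fin 4) (hf : f ≠ a) :
      CornerPath T c (T.adj i f, T.perm i f a) (T.sidePairing i f * g)

/-- The boundary holonomy is purely parabolic: the holonomy of every closed path in a boundary
component is purely parabolic or the identity. -/
def PurelyParabolicBoundary (T : CRTriangulation M ι) : Prop :=
  ∀ (c : ι × Fin 4) (g : PU21), T.CornerPath c c g → IsPurelyParabolicOrOne g

/-- The invariant `β(Δ_i)` of the `i`-th tetrahedron. -/
def tetBeta (T : CRTriangulation M ι) (i : ι) : PreBloch ℂ := configBeta (T.generic i)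

/-- The invariant `β(M)`. -/
def beta [Fintype ι] (T : CRTriangulation M ι) : PreBloch ℂ := ∑ i, T.tetBeta i

end CRTriangulation

end

/-! Choose a lift to `ℂ³` of every developed vertex. Then `δ` of each cross-ratio is an expression
in Hermitian products and determinants of lifts, and `δ(β(Δ))` turns out to be minus a sum of four
terms, one per oriented face of `Δ`, each depending only on the lifts of the three vertices of that
face (`blochDelta_configBeta`). The face term `faceWedge` changes sign when the orientation of the
face is reversed, and it is invariant under `SU(2,1)` (`faceWedge_mulVec`). So the total over all
tetrahedra cancels along glued faces as soon as the side pairings carry chosen lifts to chosen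
lifts.

This is where the boundary holonomy enters. Transporting one lift around an ideal vertex through
`SU(2,1)` lifts of the side pairings has an ambiguity coming from closed paths. A unipotent matrix
has 1 as its only eigenvalue, so it fixes the lift; what remains is the choice of `SU(2,1)` lifts,
that is, cube roots of unity (`PurelyParabolicBoundary.exists_decoration`). These are harmless,
because `ℂˣ` is divisible and so torsion dies in `∧² ℂˣ` (`faceWedge_smul`). -/

noncomputable section

/-! ### The exterior square of `ℂˣ` -/

theorem wedge_one_left {F : Type*} [Field F] (b : Fˣ) : wedge 1 b = 0 := by
  simp [wedge]

theorem wedge_pow_left {F : Type*} [Field F] (a b : Fˣ) (n : ℕ) :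
    wedge (a ^ n) b = n • wedge a b := by
  simp only [wedge, ofMul_pow, ← QuotientAddGroup.mk_nsmul, TensorProduct.smul_tmul']

theorem wedge_pow_right {F : Type*} [Field F] (a b : Fˣ) (n : ℕ) :
    wedge a (b ^ n) = n • wedge a b := by
  rw [wedge_swap, wedge_pow_left, wedge_swap b a, smul_neg, neg_neg]

theorem Complex.exists_units_pow_eq (b : ℂˣ) {n : ℕ} (hn : 0 < n) : ∃ c : ℂˣ, c ^ n = b := by
  obtain ⟨c, hc⟩ := IsAlgClosed.exists_pow_nat_eq (b : ℂ) hn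
  have hc0 : c ≠ 0 := by
    rintro rfl
    exact b.ne_zero (by rw [← hc, zero_pow hn.ne'])
  exact ⟨Units.mk0 c hc0, by ext; simpa using hc⟩

/-- Roots of unity are trivial in `∧² ℂˣ`, as `ℂˣ` is divisible. -/
theorem wedge_eq_zero_of_pow_eq_one {a : ℂˣ} {n : ℕ} (hn : 0 < n) (ha : a ^ n = 1) (b : ℂˣ) :
    wedge a b = 0 := by
  obtain ⟨c, rfl⟩ := Complex.exists_units_pow_eq b hn
  rw [wedge_pow_right, ← wedge_pow_left, ha, wedge_one_left]

/-- The defining relations give only `2 (a ∧ a) = 0`. With `a = c²` one gets `a ∧ a = 4 (c ∧ c)`,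
which vanishes. -/
theorem wedge_self (a : ℂˣ) : wedge a a = 0 := by
  obtain ⟨c, rfl⟩ := Complex.exists_units_pow_eq a two_pos
  rw [wedge_pow_left, wedge_pow_right, two_nsmul (2 • wedge c c), two_nsmul]
  have h : wedge c c + wedge c c = 0 := eq_neg_iff_add_eq_zero.1 (wedge_swap c c)
  rw [h, add_zero]

theorem wedge_neg_right (a b : ℂˣ) : wedge a (-b) = wedge a b := by
  rw [← neg_one_mul, wedge_mul_right, wedge_swap,
    wedge_eq_zero_of_pow_eq_one two_pos (by simp), neg_zero, zero_add]

/-- This is the shape of `z ∧ (1 - z)` when `z = a/c` and `1 - z = -b/c`, as happens for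
cross-ratios below; the sign and `c ∧ c` disappear, leaving a cyclically symmetric expression. -/
theorem wedge_div_neg_div (a b c : ℂˣ) :
    wedge (a * c⁻¹) (-(b * c⁻¹)) = wedge a b + wedge b c + wedge c a := by
  simp only [wedge_neg_right, wedge_mul_left, wedge_mul_right, wedge_inv_left, wedge_inv_right,
    wedge_self, wedge_swap c b, wedge_swap a c]
  abel

/-- The unit with value `x` if `x ≠ 0`, and `1` otherwise. -/
def unitOf (x : ℂ) : ℂˣ := if h : x = 0 then 1 else Units.mk0 x h

theorem unitOf_coe {x : ℂ} (h : x ≠ 0) : (unitOf x : ℂ) = x := by simp [unitOf, h]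

/-- At `x = 0` both units are the default 1, so no nonvanishing is needed. This is why the
symmetries of `cornerWedge` and `faceWedge` hold for arbitrary vectors; genericity enters only
through the cross-ratios. -/
theorem wedge_unitOf_mul_left {t : ℂ} {n : ℕ} (hn : 0 < n) (ht : t ^ n = 1) (x : ℂ) (b : ℂˣ) :
    wedge (unitOf (t * x)) b = wedge (unitOf x) b := by
  have ht0 : t ≠ 0 := by
    rintro rfl
    rw [zero_pow hn.ne'] at ht
    exact zero_ne_one ht
  by_cases hx : x = 0
  · simp [hx]
  · have h : unitOf (t * x) = Units.mk0 t ht0 * unitOf x := by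
      ext; simp [unitOf_coe, hx, ht0]
    rw [h, wedge_mul_left, wedge_eq_zero_of_pow_eq_one hn (by ext; simpa using ht), zero_add]

theorem wedge_unitOf_mul_right {t : ℂ} {n : ℕ} (hn : 0 < n) (ht : t ^ n = 1) (x : ℂ) (a : ℂˣ) :
    wedge a (unitOf (t * x)) = wedge a (unitOf x) := by
  rw [wedge_swap, wedge_unitOf_mul_left hn ht, ← wedge_swap]

/-! ### The invariant of a decorated triangle -/

/-- The Hermitian product of two vectors, as a unit. -/
def hermUnit (u v : Fin 3 → ℂ) : ℂˣ := unitOf (herm u v)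

/-- The determinant of three vectors, as a unit. -/
def detUnit (u v w : Fin 3 → ℂ) : ℂˣ := unitOf (herm w (boxProd u v))

theorem wedge_detUnit_swap_left (u v w : Fin 3 → ℂ) (b : ℂˣ) :
    wedge (detUnit v u w) b = wedge (detUnit u v w) b := by
  rw [detUnit, show herm w (boxProd v u) = -1 * herm w (boxProd u v) by
    simp only [herm_boxProd]; ring]
  exact wedge_unitOf_mul_left (n := 2) two_pos (by norm_num) _ _

theorem detUnit_rotate (u v w : Fin 3 → ℂ) : detUnit v w u = detUnit u v w := by
  rw [detUnit, detUnit]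
  congr 1
  simp only [herm_boxProd]; ring

theorem wedge_detUnit_swap_right (u v w : Fin 3 → ℂ) (b : ℂˣ) :
    wedge (detUnit u w v) b = wedge (detUnit u v w) b := by
  rw [detUnit_rotate v u w, wedge_detUnit_swap_left]

/-- The contribution of the corner at `u` of a triangle with vertex lifts `u`, `v`, `w`. -/
def cornerWedge (u v w : Fin 3 → ℂ) : WedgeSq ℂ :=
  -- These are the terms that the face `u v w` contributes to `δ` of a cross-ratio based at `u`;
  -- they do not involve the fourth vertex of the tetrahedron.
  wedge (hermUnit w u) (hermUnit v u) + wedge (detUnit u v w) (hermUnit w u)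
    - wedge (detUnit u v w) (hermUnit v u)

theorem cornerWedge_swap (u v w : Fin 3 → ℂ) : cornerWedge u w v = -cornerWedge u v w := by
  simp only [cornerWedge, wedge_detUnit_swap_right u v w]
  rw [wedge_swap (hermUnit v u)]
  abel

/-- The invariant of an oriented triangle with vertex lifts `u`, `v`, `w`. -/
def faceWedge (u v w : Fin 3 → ℂ) : WedgeSq ℂ :=
  cornerWedge u v w + cornerWedge v w u + cornerWedge w u v

theorem faceWedge_swap_left (u v w : Fin 3 → ℂ) : faceWedge v u w = -faceWedge u v w := by
  simp only [faceWedge, cornerWedge_swap u v w, cornerWedge_swap v w u, cornerWedge_swap w u v]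
  abel

theorem faceWedge_swap_right (u v w : Fin 3 → ℂ) : faceWedge u w v = -faceWedge u v w := by
  simp only [faceWedge, cornerWedge_swap u v w, cornerWedge_swap v w u, cornerWedge_swap w u v]
  abel

theorem faceWedge_reverse (u v w : Fin 3 → ℂ) : faceWedge w v u = -faceWedge u v w := by
  simp only [faceWedge, cornerWedge_swap u v w, cornerWedge_swap v w u, cornerWedge_swap w u v]
  abel

theorem herm_smul_smul (a b : ℂ) (u v : Fin 3 → ℂ) :
    herm (a • u) (b • v) = a * star b * herm u v := by
  simp only [herm_apply, Pi.smul_apply, smul_eq_mul, star_mul']; ring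

theorem herm_boxProd_smul (a b c : ℂ) (u v w : Fin 3 → ℂ) :
    herm (c • w) (boxProd (a • u) (b • v)) = a * b * c * herm w (boxProd u v) := by
  simp only [herm_boxProd, Pi.smul_apply, smul_eq_mul]; ring

/-- Rescaling the lifts by cube roots of unity does not change the invariant. -/
theorem faceWedge_smul {a b c : ℂ} (ha : a ^ 3 = 1) (hb : b ^ 3 = 1) (hc : c ^ 3 = 1)
    (u v w : Fin 3 → ℂ) : faceWedge (a • u) (b • v) (c • w) = faceWedge u v w := by
  have corner : ∀ {a b c : ℂ} (_ : a ^ 3 = 1) (_ : b ^ 3 = 1) (_ : c ^ 3 = 1) (u v w : Fin 3 → ℂ),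
      cornerWedge (a • u) (b • v) (c • w) = cornerWedge u v w := by
    intro a b c ha hb hc u v w
    have hs : ∀ {x y : ℂ}, x ^ 3 = 1 → y ^ 3 = 1 → (x * star y) ^ 3 = 1 := by
      intro x y hx hy
      rw [mul_pow, hx, ← star_pow, hy, star_one, one_mul]
    have hd : (a * b * c) ^ 3 = 1 := by rw [mul_pow, mul_pow, ha, hb, hc]; norm_num
    simp only [cornerWedge, hermUnit, detUnit, herm_smul_smul, herm_boxProd_smul,
      wedge_unitOf_mul_left three_pos hd, wedge_unitOf_mul_left three_pos (hs hc ha),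
      wedge_unitOf_mul_right three_pos (hs hc ha), wedge_unitOf_mul_right three_pos (hs hb ha)]
  simp only [faceWedge, corner ha hb hc, corner hb hc ha, corner hc ha hb]

theorem herm_boxProd_eq_det (u v w : Fin 3 → ℂ) :
    herm w (boxProd u v) = (Matrix.of ![u, v, w]).det := by
  rw [herm_boxProd, Matrix.det_fin_three]
  simp
  ring

theorem herm_boxProd_mulVec (A : Matrix (Fin 3) (Fin 3) ℂ) (u v w : Fin 3 → ℂ) :
    herm (A *ᵥ w) (boxProd (A *ᵥ u) (A *ᵥ v)) = A.det * herm w (boxProd u v) := by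
  have h : Matrix.of ![A *ᵥ u, A *ᵥ v, A *ᵥ w] = Matrix.of ![u, v, w] * Aᵀ := by
    ext i j
    fin_cases i <;> simp [Matrix.mul_apply, Matrix.mulVec, dotProduct, mul_comm]
  rw [herm_boxProd_eq_det, herm_boxProd_eq_det, h, Matrix.det_mul, Matrix.det_transpose, mul_comm]

theorem U21.herm_mulVec {A : GL (Fin 3) ℂ} (hA : A ∈ U21) (u v : Fin 3 → ℂ) :
    herm ((A : Matrix (Fin 3) (Fin 3) ℂ) *ᵥ u) ((A : Matrix (Fin 3) (Fin 3) ℂ) *ᵥ v) =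
      herm u v := by
  have hA' : (A : Matrix (Fin 3) (Fin 3) ℂ)ᴴ * matJ * (A : Matrix (Fin 3) (Fin 3) ℂ) = matJ := hA
  conv_rhs => rw [herm, ← hA']
  rw [herm, Matrix.star_mulVec]
  simp only [Matrix.dotProduct_mulVec, Matrix.vecMul_vecMul, Matrix.mul_assoc]

/-- Unitarity preserves the Hermitian products, while determinants of triples are multiplied by `det
A`; hence the normalization `det A = 1`. -/
theorem faceWedge_mulVec {A : GL (Fin 3) ℂ} (hA : A ∈ U21)
    (hdet : (A : Matrix (Fin 3) (Fin 3) ℂ).det = 1) (u v w : Fin 3 → ℂ) :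
    faceWedge ((A : Matrix (Fin 3) (Fin 3) ℂ) *ᵥ u) ((A : Matrix (Fin 3) (Fin 3) ℂ) *ᵥ v)
      ((A : Matrix (Fin 3) (Fin 3) ℂ) *ᵥ w) = faceWedge u v w := by
  simp only [faceWedge, cornerWedge, hermUnit, detUnit, U21.herm_mulVec hA, herm_boxProd_mulVec,
    hdet, one_mul]

/-! ### The map `δ` on the invariant of a configuration -/

/-- An even permutation of the vertices of the tetrahedron, sending `0` to `f`; the images of
`1`, `2`, `3` are the vertices of the face opposite to `f`. -/
def kleinPerm (f : Fin 4) : Fin 4 → Fin 4 :=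
  ![![0, 1, 2, 3], ![1, 0, 3, 2], ![2, 3, 0, 1], ![3, 2, 1, 0]] f

/-- The invariant of the face opposite to the vertex `f` of a tetrahedron with vertex lifts `v`. -/
def oppFaceWedge (v : Fin 4 → Fin 3 → ℂ) (f : Fin 4) : WedgeSq ℂ :=
  faceWedge (v (kleinPerm f 1)) (v (kleinPerm f 2)) (v (kleinPerm f 3))

/-- The mixed and purely Hermitian terms of `z ∧ (1 - z)` split among the three faces at `u`. Only
the last three terms, between determinants of different faces, do not localize on a face. -/
theorem wedge_crossRatioVec {u v w x : Fin 3 → ℂ} (hu : herm u u = 0)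
    (gv : herm v u ≠ 0) (gw : herm w u ≠ 0) (gx : herm x u ≠ 0)
    (dx : herm x (boxProd u v) ≠ 0) (dw : herm w (boxProd u v) ≠ 0)
    (dv : herm x (boxProd u w) ≠ 0) (z : NonDeg ℂ) (hz : z.1 = crossRatioVec u v w x) :
    wedge z.unit z.oneSubUnit =
      cornerWedge u v w + cornerWedge u w x + cornerWedge u x v +
        (wedge (detUnit u v x) (detUnit u w x) + wedge (detUnit u w x) (detUnit u v w) +
          wedge (detUnit u v w) (detUnit u v x)) := by
  have h1 : z.unit = (detUnit u v x * hermUnit w u) * (detUnit u v w * hermUnit x u)⁻¹ := by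
    ext
    simp only [NonDeg.unit, Units.val_mk0, hz, crossRatioVec, Units.val_mul,
      Units.val_inv_eq_inv_val, detUnit, hermUnit, unitOf_coe gw, unitOf_coe gx,
      unitOf_coe dx, unitOf_coe dw, div_eq_mul_inv]
  -- Four vectors of `ℂ³` satisfy `det(v,w,x) u - det(u,w,x) v + det(u,v,x) w - det(u,v,w) x = 0`.
  -- Pairing this with the null vector `u` kills the first term and expresses `1 - z` as a single
  -- product.
  have h2 : z.oneSubUnit =
      -((detUnit u w x * hermUnit v u) * (detUnit u v w * hermUnit x u)⁻¹) := by
    ext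
    simp only [NonDeg.oneSubUnit, Units.val_mk0, hz, crossRatioVec, Units.val_mul, Units.val_neg,
      Units.val_inv_eq_inv_val, detUnit, hermUnit, unitOf_coe gv, unitOf_coe gx,
      unitOf_coe dv, unitOf_coe dw]
    have hne := mul_ne_zero dw gx
    rw [eq_neg_iff_add_eq_zero, ← div_eq_mul_inv, sub_add_eq_add_sub, sub_eq_zero,
      ← div_self hne, ← add_div]
    congr 1
    simp only [herm_boxProd]
    simp only [herm_apply] at hu ⊢
    linear_combination (x 0 * (v 1 * w 2 - v 2 * w 1) + x 1 * (v 2 * w 0 - v 0 * w 2) +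
      x 2 * (v 0 * w 1 - v 1 * w 0)) * hu
  rw [h1, h2, wedge_div_neg_div]
  simp only [cornerWedge, wedge_mul_left, wedge_mul_right, wedge_detUnit_swap_right u v x]
  generalize hermUnit v u = a
  generalize hermUnit w u = b
  generalize hermUnit x u = c
  generalize detUnit u v w = d
  generalize detUnit u v x = e
  generalize detUnit u w x = f
  rw [wedge_swap b f, wedge_swap a d, wedge_swap c e]
  abel

/-- For any lifts `v` of the vertices, `δ(β)` is minus the sum of the invariants of the faces. -/
theorem blochDelta_configBeta {p : Fin 4 → S3} (hp : Generic p) {v : Fin 4 → Fin 3 → ℂ}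
    (hv0 : ∀ a, v a ≠ 0) (hv : ∀ a, v a ∈ (p a).1.submodule) :
    blochDelta ℂ (configBeta hp) = -∑ f, oppFaceWedge v f := by
  have hc : ∀ a, ∃ c : ℂ, c ≠ 0 ∧ v a = c • (p a).rep := by
    intro a
    have h := hv a
    rw [S3.submodule_eq, Submodule.mem_span_singleton] at h
    obtain ⟨c, hc⟩ := h
    refine ⟨c, ?_, hc.symm⟩
    rintro rfl
    exact hv0 a (by rw [← hc, zero_smul])
  choose c hc0 hc using hc
  have hnull : ∀ a, herm (v a) (v a) = 0 := fun a => (p a).2 _ (hv a)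
  have hg : ∀ {a b}, a ≠ b → herm (v a) (v b) ≠ 0 := by
    intro a b hab
    rw [hc a, hc b, herm_smul_smul]
    exact mul_ne_zero (mul_ne_zero (hc0 a) (star_ne_zero.2 (hc0 b)))
      (S3.herm_ne_zero (hp.1.ne hab))
  have hd : ∀ {a b d}, a ≠ b → b ≠ d → a ≠ d → herm (v d) (boxProd (v a) (v b)) ≠ 0 := by
    intro a b d hab hbd had
    rw [hc a, hc b, hc d, herm_boxProd_smul]
    exact mul_ne_zero (mul_ne_zero (mul_ne_zero (hc0 a) (hc0 b)) (hc0 d))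
      (hp.det_ne_zero hab hbd had)
  have hgen : ∀ (i j k l : Fin 4) (h : Function.Injective ![i, j, k, l]),
      blochDelta ℂ (hp.gen i j k l h) =
        cornerWedge (v i) (v j) (v k) + cornerWedge (v i) (v k) (v l) +
            cornerWedge (v i) (v l) (v j) +
          (wedge (detUnit (v i) (v j) (v l)) (detUnit (v i) (v k) (v l)) +
            wedge (detUnit (v i) (v k) (v l)) (detUnit (v i) (v j) (v k)) +
            wedge (detUnit (v i) (v j) (v k)) (detUnit (v i) (v j) (v l))) := by
    intro i j k l h
    have hij : i ≠ j := fun e => absurd (@h 0 1 (by simpa using e)) (by decide)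
    have hik : i ≠ k := fun e => absurd (@h 0 2 (by simpa using e)) (by decide)
    have hil : i ≠ l := fun e => absurd (@h 0 3 (by simpa using e)) (by decide)
    have hjk : j ≠ k := fun e => absurd (@h 1 2 (by simpa using e)) (by decide)
    have hjl : j ≠ l := fun e => absurd (@h 1 3 (by simpa using e)) (by decide)
    have hkl : k ≠ l := fun e => absurd (@h 2 3 (by simpa using e)) (by decide)
    rw [← wedge_crossRatioVec (hnull i) (hg hij.symm) (hg hik.symm) (hg hil.symm)
      (hd hij hjl hil) (hd hij hjk hik) (hd hik hkl hil)
      ⟨crossRatio (p i) (p j) (p k) (p l), hp.crossRatio_ne h⟩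
      (by rw [hc i, hc j, hc k, hc l, crossRatioVec_smul (hc0 i) (hc0 j) (hc0 k) (hc0 l)]; rfl)]
    simp [Generic.gen, PreBloch.of, blochDelta, freeDelta]
  have rotate : ∀ a b d, detUnit (v b) (v d) (v a) = detUnit (v a) (v b) (v d) :=
    fun _ _ _ => detUnit_rotate _ _ _
  have hl : ∀ (a b d : Fin 4) (x : ℂˣ),
      wedge (detUnit (v b) (v a) (v d)) x = wedge (detUnit (v a) (v b) (v d)) x :=
    fun _ _ _ _ => wedge_detUnit_swap_left _ _ _ _
  have hr : ∀ (a b d : Fin 4) (x : ℂˣ),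
      wedge x (detUnit (v b) (v a) (v d)) = wedge x (detUnit (v a) (v b) (v d)) := by
    intro a b d x
    rw [wedge_swap, hl, ← wedge_swap]
  have swap : ∀ a b d, cornerWedge (v a) (v d) (v b) = -cornerWedge (v a) (v b) (v d) :=
    fun _ _ _ => cornerWedge_swap _ _ _
  simp only [configBeta, map_add, hgen, Fin.sum_univ_four, oppFaceWedge, faceWedge, kleinPerm,
    Matrix.cons_val]
  -- Determinants are brought to increasing indices: cyclic rotations preserve them, and a
  -- transposition costs a sign, which is invisible to `wedge`. The twelve corner terms are then
  -- given matching orientations.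
  rw [← rotate 2 0 1, rotate 1 2 3, rotate 0 2 3, rotate 2 1 3, ← rotate 3 2 0, ← rotate 3 1 0,
    ← rotate 3 2 1]
  simp only [hl 1 2 3, hl 0 2 3, hl 0 1 3, hl 0 1 2, hr 1 2 3, hr 0 2 3, hr 0 1 3, hr 0 1 2]
  rw [swap 1 3 2, swap 2 1 3, swap 3 2 1, swap 0 2 3, swap 3 0 2, swap 2 3 0, swap 3 1 0,
    swap 0 3 1, swap 1 0 3, swap 2 0 1, swap 1 2 0, swap 0 1 2]
  -- Two faces share an edge, so the wedge of their determinants occurs once for each end of that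
  -- edge, with opposite signs: the terms that were not localized cancel.
  rw [wedge_swap (detUnit (v 0) (v 2) (v 3)) (detUnit (v 0) (v 1) (v 3)),
    wedge_swap (detUnit (v 0) (v 2) (v 3)) (detUnit (v 0) (v 1) (v 2)),
    wedge_swap (detUnit (v 0) (v 1) (v 3)) (detUnit (v 0) (v 1) (v 2)),
    wedge_swap (detUnit (v 1) (v 2) (v 3)) (detUnit (v 0) (v 1) (v 2)),
    wedge_swap (detUnit (v 1) (v 2) (v 3)) (detUnit (v 0) (v 1) (v 3)),
    wedge_swap (detUnit (v 1) (v 2) (v 3)) (detUnit (v 0) (v 2) (v 3))]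
  abel

/-! ### Lifts of elements of `PU(2,1)` -/

theorem IsLift.mulVec_mem {A : GL (Fin 3) ℂ} {g : Equiv.Perm S3} (hA : IsLift A g) {p : S3}
    {v : Fin 3 → ℂ} (hv : v ∈ p.1.submodule) :
    (A : Matrix (Fin 3) (Fin 3) ℂ) *ᵥ v ∈ (g p).1.submodule := by
  rw [hA p]
  exact ⟨v, hv, rfl⟩

theorem S3.ext_submodule {p q : S3} (h : p.1.submodule = q.1.submodule) : p = q :=
  Subtype.ext (Projectivization.submodule_injective h)

theorem mulVec_injective (A : GL (Fin 3) ℂ) :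
    Function.Injective fun v => (A : Matrix (Fin 3) (Fin 3) ℂ) *ᵥ v :=
  Matrix.mulVec_injective_of_isUnit A.isUnit

/-- A transformation fixing three points in generic position lifts to scalar matrices only. -/
theorem IsLift.eq_smul_one {A : GL (Fin 3) ℂ} (hAU : A ∈ U21) {g : Equiv.Perm S3}
    (hA : IsLift A g) {n : ℕ} {p : Fin n → S3} (hp : Generic p) {i j k : Fin n} (hij : i ≠ j)
    (hjk : j ≠ k) (hik : i ≠ k) (hi : g (p i) = p i) (hj : g (p j) = p j) (hk : g (p k) = p k) :
    ∃ c : ℂ, c ≠ 0 ∧ (A : Matrix (Fin 3) (Fin 3) ℂ) = c • 1 := by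
  have eig : ∀ q : S3, g q = q →
      ∃ c : ℂ, c ≠ 0 ∧ (A : Matrix (Fin 3) (Fin 3) ℂ) *ᵥ q.rep = c • q.rep := by
    intro q hq
    have h := hA.mulVec_mem (p := q) (v := q.rep)
      (by rw [S3.submodule_eq]; exact Submodule.mem_span_singleton_self _)
    rw [hq, S3.submodule_eq, Submodule.mem_span_singleton] at h
    obtain ⟨c, hc⟩ := h
    refine ⟨c, ?_, hc.symm⟩
    rintro rfl
    refine q.rep_ne_zero (mulVec_injective A ?_)
    simp [← hc]
  obtain ⟨a, ha0, ha⟩ := eig _ hi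
  obtain ⟨b, hb0, hb⟩ := eig _ hj
  obtain ⟨c, hc0, hc⟩ := eig _ hk
  -- Distinct points of `S³` have nonzero Hermitian product, so unitarity relates their eigenvalues.
  -- The relations for three points force the three eigenvalues to agree.
  have prod : ∀ {q r : S3} {x y : ℂ}, q ≠ r →
      (A : Matrix (Fin 3) (Fin 3) ℂ) *ᵥ q.rep = x • q.rep →
      (A : Matrix (Fin 3) (Fin 3) ℂ) *ᵥ r.rep = y • r.rep → x * star y = 1 := by
    intro q r x y hqr hx hy
    have h := U21.herm_mulVec hAU q.rep r.rep
    rw [hx, hy, herm_smul_smul] at h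
    exact mul_right_cancel₀ (S3.herm_ne_zero hqr) (by rw [h, one_mul])
  have hab := prod (hp.1.ne hij) ha hb
  have hac := prod (hp.1.ne hik) ha hc
  have hcb := prod (hp.1.ne hjk.symm) hc hb
  have hbc : b = c := star_injective (mul_left_cancel₀ ha0 (hab.trans hac.symm))
  have hca : a = c := mul_right_cancel₀ (star_ne_zero.2 hb0) (hab.trans hcb.symm)
  subst hbc hca
  refine ⟨a, ha0, ?_⟩
  -- By genericity the three eigenvectors form a basis, so equality with a scalar matrix can be
  -- tested on them.
  have hdet := hp.det_ne_zero hij hjk hik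
  rw [herm_boxProd_eq_det] at hdet
  have hunit := (Matrix.isUnit_iff_isUnit_det _).2 (isUnit_iff_ne_zero.2 hdet)
  have hmul : Matrix.of ![(p i).rep, (p j).rep, (p k).rep] * (A : Matrix (Fin 3) (Fin 3) ℂ)ᵀ =
      Matrix.of ![(p i).rep, (p j).rep, (p k).rep] * (a • 1) := by
    rw [Matrix.mul_smul, Matrix.mul_one]
    ext s t
    have e : ∀ r : Fin 3 → ℂ, (A : Matrix (Fin 3) (Fin 3) ℂ) *ᵥ r = a • r →
        r ⬝ᵥ (A : Matrix (Fin 3) (Fin 3) ℂ) t = a * r t := by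
      intro r hr
      rw [dotProduct_comm]
      exact congrFun hr t
    fin_cases s
    · simpa [Matrix.mul_apply, dotProduct] using e _ ha
    · simpa [Matrix.mul_apply, dotProduct] using e _ hb
    · simpa [Matrix.mul_apply, dotProduct] using e _ hc
  have := hunit.mul_left_cancel hmul
  rw [← Matrix.transpose_transpose (A : Matrix (Fin 3) (Fin 3) ℂ), this]
  simp

/-- Consequently a side pairing is determined by its values at the three vertices of its face. -/
theorem eq_one_of_fixes_generic (g : PU21) {n : ℕ} {p : Fin n → S3} (hp : Generic p)
    {i j k : Fin n} (hij : i ≠ j) (hjk : j ≠ k) (hik : i ≠ k)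
    (hi : (g : Equiv.Perm S3) (p i) = p i) (hj : (g : Equiv.Perm S3) (p j) = p j)
    (hk : (g : Equiv.Perm S3) (p k) = p k) : g = 1 := by
  obtain ⟨g, A, hAU, hA⟩ := g
  obtain ⟨c, hc0, hc⟩ := hA.eq_smul_one hAU hp hij hjk hik hi hj hk
  refine Subtype.ext (Equiv.ext fun q => S3.ext_submodule ?_)
  show (g q).1.submodule = q.1.submodule
  rw [hA q, hc, S3.submodule_eq, Submodule.map_span, Set.image_singleton]
  simpa using Submodule.span_singleton_smul_eq (IsUnit.mk0 c hc0) q.rep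

theorem U21.star_det_mul_det {A : GL (Fin 3) ℂ} (hA : A ∈ U21) :
    star (A : Matrix (Fin 3) (Fin 3) ℂ).det * (A : Matrix (Fin 3) (Fin 3) ℂ).det = 1 := by
  have hA' : (A : Matrix (Fin 3) (Fin 3) ℂ)ᴴ * matJ * (A : Matrix (Fin 3) (Fin 3) ℂ) = matJ := hA
  have h := congrArg Matrix.det hA'
  have hJ : matJ.det = -1 := by simp [matJ, Matrix.det_fin_three]
  rw [Matrix.det_mul, Matrix.det_mul, Matrix.det_conjTranspose, hJ] at h
  linear_combination -h

/-- Every element of `PU(2,1)` lifts to `SU(2,1)`. -/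
theorem PU21.exists_lift_det_eq_one (g : PU21) : ∃ A ∈ U21, IsLift A (g : Equiv.Perm S3) ∧
    (A : Matrix (Fin 3) (Fin 3) ℂ).det = 1 := by
  obtain ⟨g, A, hAU, hA⟩ := g
  have hd := U21.star_det_mul_det hAU
  set d := (A : Matrix (Fin 3) (Fin 3) ℂ).det with hdef
  have hd0 : d ≠ 0 := by
    intro h
    rw [h, mul_zero] at hd
    exact zero_ne_one hd
  -- Rescaling by `c` multiplies the determinant by `c³ = d⁻¹`. Since `|d| = 1`, also `|c| = 1`, so
  -- the rescaled matrix stays unitary.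
  obtain ⟨c, hc⟩ := IsAlgClosed.exists_pow_nat_eq d⁻¹ three_pos
  have hc0 : c ≠ 0 := by
    rintro rfl
    exact inv_ne_zero hd0 (by rw [← hc]; simp)
  have hnd : ‖d‖ = 1 := by
    have h := congrArg norm hd
    rw [norm_mul, norm_star, norm_one, ← sq] at h
    exact (pow_eq_one_iff_of_nonneg (norm_nonneg _) two_ne_zero).1 h
  have hnc : ‖c‖ = 1 := by
    have h := congrArg norm hc
    rw [norm_pow, norm_inv, hnd, inv_one] at h
    exact (pow_eq_one_iff_of_nonneg (norm_nonneg _) three_ne_zero).1 h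
  have hcc : star c * c = 1 := by
    rw [Complex.star_def, Complex.conj_mul', hnc]; simp
  have hdet : (c • (A : Matrix (Fin 3) (Fin 3) ℂ)).det = 1 := by
    rw [Matrix.det_smul, Fintype.card_fin, hc, ← hdef, inv_mul_cancel₀ hd0]
  refine ⟨Matrix.GeneralLinearGroup.mkOfDetNeZero (c • (A : Matrix (Fin 3) (Fin 3) ℂ))
    (by rw [hdet]; exact one_ne_zero), ?_, ?_, hdet⟩
  · have hA' : (A : Matrix (Fin 3) (Fin 3) ℂ)ᴴ * matJ * (A : Matrix (Fin 3) (Fin 3) ℂ) = matJ := hAU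
    show (c • (A : Matrix (Fin 3) (Fin 3) ℂ))ᴴ * matJ * (c • (A : Matrix (Fin 3) (Fin 3) ℂ)) = matJ
    rw [Matrix.conjTranspose_smul, Matrix.smul_mul, Matrix.smul_mul, Matrix.mul_smul, smul_smul,
      hA', hcc, one_smul]
  · intro p
    show (g p).1.submodule =
      p.1.submodule.map (Matrix.mulVecLin (c • (A : Matrix (Fin 3) (Fin 3) ℂ)))
    rw [hA p, S3.submodule_eq, Submodule.map_span, Submodule.map_span, Set.image_singleton,
      Set.image_singleton, Matrix.mulVecLin_apply, Matrix.mulVecLin_apply, Matrix.smul_mulVec,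
      Submodule.span_singleton_smul_eq (IsUnit.mk0 c hc0)]

/-- The nilpotent matrix `1 - A` has characteristic polynomial `X ^ n`; its value at 1 is `det A`.
-/
theorem det_eq_one_of_isNilpotent_sub_one {n K : Type*} [Fintype n] [DecidableEq n] [Field K]
    {A : Matrix n n K} (h : IsNilpotent (A - 1)) : A.det = 1 := by
  have h' : IsNilpotent (1 - A) := by rw [← neg_sub]; exact h.neg
  have hχ := sub_eq_zero.1 (Matrix.isNilpotent_charpoly_sub_pow_of_isNilpotent h').eq_zero
  have := congrArg (Polynomial.eval 1) hχ
  rw [Matrix.eval_charpoly] at this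
  simpa using this

/-- Applied to a lift of an ideal vertex, this is what removes the multivaluedness of the
transported lift: the holonomy fixes the vertex in `S³`, hence has its lift as an eigenvector. -/
theorem mulVec_eq_self_of_isNilpotent_sub_one {n K : Type*} [Fintype n] [DecidableEq n] [Field K]
    {A : Matrix n n K} (h : IsNilpotent (A - 1)) {v : n → K} (hv : v ≠ 0) {c : K}
    (hc : A *ᵥ v = c • v) : A *ᵥ v = v := by
  obtain ⟨m, hm⟩ := h
  have hpow : ∀ m : ℕ, (A - 1) ^ m *ᵥ v = (c - 1) ^ m • v := by
    intro m
    induction m with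
    | zero => simp
    | succ m ih =>
      rw [pow_succ, ← Matrix.mulVec_mulVec, Matrix.sub_mulVec, hc, Matrix.one_mulVec,
        show c • v - v = (c - 1) • v by rw [sub_smul, one_smul], Matrix.mulVec_smul, ih, smul_smul,
        pow_succ, mul_comm]
  have h0 := hpow m
  rw [hm, Matrix.zero_mulVec] at h0
  have h1 : (c - 1) ^ m = 0 := (smul_eq_zero.1 h0.symm).resolve_right hv
  rw [hc, sub_eq_zero.1 (eq_zero_of_pow_eq_zero h1), one_smul]

/-! ### Decorations of a triangulation -/

namespace CRTriangulation

variable {M : Type*} [TopologicalSpace M] [ChartedSpace S3 M] {ι : Type*}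

/-- The developed vertex of a corner. -/
def corner (T : CRTriangulation M ι) (c : ι × Fin 4) : S3 := T.dev c.1 (stdSimplex.vertex c.2)

theorem sidePairing_corner (T : CRTriangulation M ι) (i : ι) {f b : Fin 4} (hb : b ≠ f) :
    (T.sidePairing i f : Equiv.Perm S3) (T.corner (i, b)) =
      T.corner (T.adj i f, T.perm i f b) := by
  have h := T.sidePairing_dev i f (stdSimplex.vertex b) (by simp [hb.symm])
  rw [stdSimplex.map_vertex] at h
  exact h.symm

theorem adj_perm_adj_perm (T : CRTriangulation M ι) (i : ι) (f b : Fin 4) :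
    (T.adj (T.adj i f) (T.perm i f f), T.perm (T.adj i f) (T.perm i f f) (T.perm i f b)) =
      (i, b) := by
  rw [T.adj_adj, T.perm_perm, ← Equiv.Perm.mul_apply, inv_mul_cancel, Equiv.Perm.one_apply]

/-- This is not part of the data of a triangulation: crossing a face and coming back fixes the three
generic vertices of the face, hence is the identity. -/
theorem sidePairing_adj (T : CRTriangulation M ι) (i : ι) (f : Fin 4) :
    T.sidePairing (T.adj i f) (T.perm i f f) = (T.sidePairing i f)⁻¹ := by
  rw [eq_inv_iff_mul_eq_one]
  have fix : ∀ b, b ≠ f →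
      ((T.sidePairing (T.adj i f) (T.perm i f f) * T.sidePairing i f : PU21) : Equiv.Perm S3)
        (T.corner (i, b)) = T.corner (i, b) := by
    intro b hb
    rw [Subgroup.coe_mul, Equiv.Perm.mul_apply, sidePairing_corner T i hb,
      sidePairing_corner T _ ((T.perm i f).injective.ne hb), adj_perm_adj_perm]
  have h : ∀ f : Fin 4, kleinPerm f 1 ≠ f ∧ kleinPerm f 2 ≠ f ∧ kleinPerm f 3 ≠ f ∧
      kleinPerm f 1 ≠ kleinPerm f 2 ∧ kleinPerm f 2 ≠ kleinPerm f 3 ∧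
      kleinPerm f 1 ≠ kleinPerm f 3 := by decide
  obtain ⟨h1, h2, h3, h12, h23, h13⟩ := h f
  exact eq_one_of_fixes_generic _ (T.generic i) h12 h23 h13 (fix _ h1) (fix _ h2) (fix _ h3)

theorem CornerPath.trans {T : CRTriangulation M ι} {c c' c'' : ι × Fin 4} {g g' : PU21}
    (h : T.CornerPath c c' g) (h' : T.CornerPath c' c'' g') : T.CornerPath c c'' (g' * g) := by
  induction h' with
  | refl => rwa [one_mul]
  | step _ f hf ih => rw [mul_assoc]; exact ih.step f hf

theorem CornerPath.single (T : CRTriangulation M ι) (i : ι) {f a : Fin 4} (hf : f ≠ a) :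
    T.CornerPath (i, a) (T.adj i f, T.perm i f a) (T.sidePairing i f) := by
  simpa using CornerPath.step (CornerPath.refl (T := T) (c := (i, a))) f hf

theorem CornerPath.symm {T : CRTriangulation M ι} {c c' : ι × Fin 4} {g : PU21}
    (h : T.CornerPath c c' g) : T.CornerPath c' c g⁻¹ := by
  induction h with
  | refl => rw [inv_one]; exact .refl
  | @step i a g _ f hf ih =>
    have hback := CornerPath.single T (T.adj i f) ((T.perm i f).injective.ne hf)
    rw [adj_perm_adj_perm, sidePairing_adj] at hback
    rw [mul_inv_rev]
    exact hback.trans ih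

theorem CornerPath.apply_corner {T : CRTriangulation M ι} {c c' : ι × Fin 4} {g : PU21}
    (h : T.CornerPath c c' g) : (g : Equiv.Perm S3) (T.corner c) = T.corner c' := by
  induction h with
  | refl => rfl
  | step _ f hf ih =>
    rw [Subgroup.coe_mul, Equiv.Perm.mul_apply, ih, sidePairing_corner T _ hf.symm]

/-- Two corners at the same ideal vertex. -/
def cornerSetoid (T : CRTriangulation M ι) : Setoid (ι × Fin 4) where
  r c c' := ∃ g, T.CornerPath c c' g
  iseqv :=
    { refl := fun _ => ⟨1, .refl⟩
      symm := fun ⟨_, h⟩ => ⟨_, h.symm⟩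
      trans := fun ⟨_, h⟩ ⟨_, h'⟩ => ⟨_, h.trans h'⟩ }

/-- If the boundary holonomy is purely parabolic, lifts of the developed vertices can be chosen
compatibly with the lifts of the side pairings to `SU(2,1)`, up to cube roots of unity. -/
theorem PurelyParabolicBoundary.exists_decoration {T : CRTriangulation M ι}
    (hT : T.PurelyParabolicBoundary) :
    ∃ v : ι × Fin 4 → Fin 3 → ℂ, (∀ c, v c ≠ 0) ∧ (∀ c, v c ∈ (T.corner c).1.submodule) ∧
      ∀ (i : ι) (f a : Fin 4), a ≠ f → ∀ S ∈ U21, IsLift S (T.sidePairing i f : Equiv.Perm S3) →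
        (S : Matrix (Fin 3) (Fin 3) ℂ).det = 1 →
        ∃ ζ : ℂ, ζ ^ 3 = 1 ∧ (S : Matrix (Fin 3) (Fin 3) ℂ) *ᵥ v (i, a) =
          ζ • v (T.adj i f, T.perm i f a) := by
  -- One base corner `r c` per ideal vertex; its lift is transported to `c` by an `SU(2,1)` lift `A
  -- c` of the holonomy of a chosen path.
  let r : ι × Fin 4 → ι × Fin 4 := fun c => (Quotient.mk T.cornerSetoid c).out
  have hr : ∀ c, ∃ g, T.CornerPath (r c) c g := fun c => Quotient.mk_out (s := T.cornerSetoid) c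
  choose g hg using hr
  choose A hAU hA hAdet using fun c => PU21.exists_lift_det_eq_one (g c)
  have hrep : ∀ c, (T.corner (r c)).rep ∈ (T.corner (r c)).1.submodule := fun c => by
    rw [S3.submodule_eq]; exact Submodule.mem_span_singleton_self _
  refine ⟨fun c => (A c : Matrix (Fin 3) (Fin 3) ℂ) *ᵥ (T.corner (r c)).rep, fun c h => ?_,
    fun c => ?_, ?_⟩
  · exact (T.corner (r c)).rep_ne_zero (mulVec_injective (A c) (by simpa using h))
  · rw [← (hg c).apply_corner]
    exact (hA c).mulVec_mem (hrep c)
  intro i f a haf S hSU hS hSdet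
  set c : ι × Fin 4 := (i, a) with hc
  set c' : ι × Fin 4 := (T.adj i f, T.perm i f a) with hc'
  have hstep : T.CornerPath c c' (T.sidePairing i f) := CornerPath.single T i haf.symm
  have hrr : r c' = r c :=
    congrArg Quotient.out (Quotient.sound (s := T.cornerSetoid) ⟨_, hstep.symm⟩)
  have hback := (hg c').symm
  rw [hrr] at hback
  -- The loop from the base corner to `c`, across the face to `c'`, and back along the path chosen
  -- for `c'`: its holonomy has a unipotent lift `U`.
  have hloop := ((hg c).trans hstep).trans hback
  obtain ⟨U, hUU, hU, hUnil⟩ := hT _ _ hloop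
  have hB : IsLift ((A c')⁻¹ * (S * A c))
      (((g c')⁻¹ * (T.sidePairing i f * g c) : PU21) : Equiv.Perm S3) :=
    (hA c').inv.mul (hS.mul (hA c))
  -- `U` and `(A c')⁻¹ S (A c)` lift the same transformation, so they differ by a scalar `ζ`. Any
  -- generic triple serves to see this; vertices of tetrahedron `i` are used.
  have hUB := hU.inv.mul hB
  rw [inv_mul_cancel] at hUB
  have hUBU : U⁻¹ * ((A c')⁻¹ * (S * A c)) ∈ U21 :=
    mul_mem (inv_mem hUU) (mul_mem (inv_mem (hAU c')) (mul_mem hSU (hAU c)))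
  obtain ⟨ζ, -, hζ⟩ := hUB.eq_smul_one hUBU (T.generic i) (i := 0) (j := 1) (k := 2)
    (by decide) (by decide) (by decide) rfl rfl rfl
  have hSA : (S : Matrix (Fin 3) (Fin 3) ℂ) * (A c : Matrix (Fin 3) (Fin 3) ℂ) =
      ζ • ((A c' : Matrix (Fin 3) (Fin 3) ℂ) * (U : Matrix (Fin 3) (Fin 3) ℂ)) := by
    have h : S * A c = A c' * U * (U⁻¹ * ((A c')⁻¹ * (S * A c))) := by group
    rw [← Units.val_mul, h, Units.val_mul, hζ, Matrix.mul_smul, Matrix.mul_one, Units.val_mul]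
  refine ⟨ζ, ?_, ?_⟩
  -- All four matrices have determinant 1, so comparing determinants leaves `ζ³ = 1`.
  · have h := congrArg Matrix.det hSA
    rwa [Matrix.det_smul, Matrix.det_mul, Matrix.det_mul, hSdet, hAdet, hAdet,
      det_eq_one_of_isNilpotent_sub_one hUnil, Fintype.card_fin, mul_one, mul_one, eq_comm] at h
  · have hUfix : (U : Matrix (Fin 3) (Fin 3) ℂ) *ᵥ (T.corner (r c)).rep =
        (T.corner (r c)).rep := by
      have hmem := hU.mulVec_mem (hrep c)
      rw [hloop.apply_corner, S3.submodule_eq, Submodule.mem_span_singleton] at hmem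
      obtain ⟨x, hx⟩ := hmem
      exact mulVec_eq_self_of_isNilpotent_sub_one hUnil (S3.rep_ne_zero _) hx.symm
    show _ *ᵥ (_ *ᵥ _) = ζ • (_ *ᵥ (T.corner (r c')).rep)
    rw [hrr, Matrix.mulVec_mulVec, hSA, Matrix.smul_mulVec, ← Matrix.mulVec_mulVec, hUfix]

end CRTriangulation

/-! ### Cancellation along glued faces -/

/-- An odd permutation reverses the orientations of the faces of the tetrahedron. -/
theorem oppFaceWedge_perm (v : Fin 4 → Fin 3 → ℂ) (σ : Equiv.Perm (Fin 4))
    (hσ : Equiv.Perm.sign σ = -1) (f : Fin 4) :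
    oppFaceWedge v (σ f) = -oppFaceWedge (v ∘ σ) f := by
  -- The permutation `(kleinPerm (σ f))⁻¹ ∘ σ ∘ kleinPerm f` is odd and fixes 0, hence is one of the
  -- three transpositions of 1, 2, 3.
  have h : ∀ σ : Equiv.Perm (Fin 4), Equiv.Perm.sign σ = -1 → ∀ f : Fin 4,
      (kleinPerm (σ f) 1 = σ (kleinPerm f 2) ∧ kleinPerm (σ f) 2 = σ (kleinPerm f 1) ∧
        kleinPerm (σ f) 3 = σ (kleinPerm f 3)) ∨
      (kleinPerm (σ f) 1 = σ (kleinPerm f 1) ∧ kleinPerm (σ f) 2 = σ (kleinPerm f 3) ∧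
        kleinPerm (σ f) 3 = σ (kleinPerm f 2)) ∨
      (kleinPerm (σ f) 1 = σ (kleinPerm f 3) ∧ kleinPerm (σ f) 2 = σ (kleinPerm f 2) ∧
        kleinPerm (σ f) 3 = σ (kleinPerm f 1)) := by decide
  simp only [oppFaceWedge, Function.comp_apply]
  rcases h σ hσ f with ⟨h1, h2, h3⟩ | ⟨h1, h2, h3⟩ | ⟨h1, h2, h3⟩ <;> rw [h1, h2, h3]
  · exact faceWedge_swap_left _ _ _
  · exact faceWedge_swap_right _ _ _
  · exact faceWedge_reverse _ _ _

end

theorem mainTheorem2 {M : Type*} [TopologicalSpace M] [T2Space M] [SecondCountableTopology M]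
    [NoncompactSpace M] [ChartedSpace S3 M] [HasGroupoid M sphericalCRGroupoid]
    {ι : Type*} [Fintype ι] (T : CRTriangulation M ι) (hT : T.PurelyParabolicBoundary) :
    T.beta ∈ blochGroup ℂ ∧ ∑ i, blochDelta ℂ (T.tetBeta i) = 0 := by
  have hsum : ∑ i, blochDelta ℂ (T.tetBeta i) = 0 := by
    obtain ⟨v, hv0, hv, hvS⟩ := hT.exists_decoration
    have htet : ∀ i, blochDelta ℂ (T.tetBeta i) = -∑ f, oppFaceWedge (fun a => v (i, a)) f :=
      fun i => blochDelta_configBeta (T.generic i) (fun a => hv0 (i, a)) fun a => hv (i, a)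
    simp only [htet, Finset.sum_neg_distrib, neg_eq_zero]
    rw [← Fintype.sum_prod_type' fun i f => oppFaceWedge (fun a => v (i, a)) f]
    -- Each pair (tetrahedron, face) is matched with the face glued to it; no face is glued to
    -- itself, so it suffices that matched terms add up to zero.
    refine Finset.sum_involution (fun x _ => (T.adj x.1 x.2, T.perm x.1 x.2 x.2)) ?_
      (fun x _ _ => T.not_self x.1 x.2) (fun _ _ => Finset.mem_univ _)
      fun x _ => T.adj_perm_adj_perm x.1 x.2 x.2
    rintro ⟨i, f⟩ -
    dsimp only
    rw [oppFaceWedge_perm _ _ (T.odd i f), add_neg_eq_zero]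
    obtain ⟨S, hSU, hS, hSdet⟩ := PU21.exists_lift_det_eq_one (T.sidePairing i f)
    have hne : ∀ f : Fin 4, kleinPerm f 1 ≠ f ∧ kleinPerm f 2 ≠ f ∧ kleinPerm f 3 ≠ f := by decide
    obtain ⟨h1, h2, h3⟩ := hne f
    obtain ⟨a, ha, ea⟩ := hvS i f _ h1 S hSU hS hSdet
    obtain ⟨b, hb, eb⟩ := hvS i f _ h2 S hSU hS hSdet
    obtain ⟨c, hc, ec⟩ := hvS i f _ h3 S hSU hS hSdet
    -- The odd gluing has supplied the sign; moving the face by `S` and dropping the cube roots of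
    -- unity gives the lifts on the glued face.
    rw [oppFaceWedge, ← faceWedge_mulVec hSU hSdet, ea, eb, ec, faceWedge_smul ha hb hc]
    rfl
  refine ⟨?_, hsum⟩
  rw [blochGroup, AddMonoidHom.mem_ker, CRTriangulation.beta, map_sum, hsum]
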